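/- Let $(\Omega,\Sigma)$ be a measurable space. Let $B(\Omega,\Sigma)$ be the set of bounded measurable functions $\Omega\to\mathbb{R}$, $\mathcal{P}(\Omega,\Sigma)$ the set of finitely additive probability measures on $\Sigma$, and $\mathcal{P}_c(\Omega,\Sigma)\subseteq\mathcal{P}(\Omega,\Sigma)$ the set of countably additive ones; $P\ll Q$ means that $Q(E)=0$ implies $P(E)=0$ for all $E\in\Sigma$. Let $f:\mathbb{R}\to(-\infty,\infty]$ be a lower semicontinuous convex function such that $f(1)=0$, $f$ is finite in a neighbourhood of $1$, and $f(x)=\infty$ for every $x<0$, and let $f^*(s)=\sup_{x\in\mathbb{R}}(xs-f(x))$ be its convex conjugate. For $P\in\mathcal{P}(\Omega,\Sigma)$, $Q\in\mathcal{P}_c(\Omega,\Sigma)$ and $H\subseteq B(\Omega,\Sigma)$ define the restricted $f$-divergence $$D_{f,H}(P\|Q)=\sup_{h\in H}\big(\mathbb{E}_P[h]-\mathbb{E}_Q[f^*(h)]\big),$$ and the extended $f$-divergence $$\bar D_f(P\|Q)=\begin{cases}\int_\Omega f\!\left(\frac{dP}{dQ}\right)dQ, & P\in\mathcal{P}_c(\Omega,\Sigma)\text{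 and }P\ll Q,\\ \sup_{h\in B(\Omega,\Sigma)}\big(\mathbb{E}_P[h]-\mathbb{E}_Q[f^*(h)]\big), & \text{otherwise.}\end{cases}$$ If $H$ is a convex subset of $B(\Omega,\Sigma)$ such that $h+b\in H$ for all $h\in H$ and $b\in\mathbb{R}$, then for every $P\in\mathcal{P}(\Omega,\Sigma)$ and $Q\in\mathcal{P}_c(\Omega,\Sigma)$ $$D_{f,H}(P\|Q)=\inf_{P'\in\mathcal{P}(\Omega,\Sigma)}\Big(\bar D_f(P'\|Q)+\sup_{h\in H}\big(\mathbb{E}_P[h]-\mathbb{E}_{P'}[h]\big)\Big)=\inf_{\substack{P'\in\mathcal{P}(\Omega,\Sigma)\\P'\ll Q}}\Big(\bar D_f(P'\|Q)+\sup_{h\in H}\big(\mathbb{E}_P[h]-\mathbb{E}_{P'}[h]\big)\Big).$$ (For $H=\emptyset$ the conventions $\sup\emptyset=-\infty$ and $\infty+(-\infty)=-\infty$ are used.) -/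

import Mathlib

open MeasureTheory Set
open scoped ENNReal NNReal

noncomputable section

/-- A finitely additive probability measure on the measurable space `Ω`. Only the values on
measurable sets are meaningful (nothing below looks at the others). -/
structure FinAddProb (Ω : Type*) [MeasurableSpace Ω] where
  /-- the underlying finitely additive set function on the σ-algebra -/
  content : AddContent ℝ≥0 {s : Set Ω | MeasurableSet s}
  content_univ : content univ = 1

namespace FinAddProb

variable {Ω : Type*} [MeasurableSpace Ω]

/-- The integral (expectation) of a bounded measurable function against a finitely additive
probability measure: the supremum of the integrals `∑ c, c * P (s = c)` of the measurable simple
functions `s ≤ h`. -/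
def expect (P : FinAddProb Ω) (h : Ω → ℝ) : ℝ :=
  ⨆ s : {s : SimpleFunc Ω ℝ // ∀ x, s x ≤ h x},
    ∑ c ∈ s.1.range, c * (P.content (s.1 ⁻¹' {c}) : ℝ)

/-- `P ≪ Q`: every measurable set that is null for `Q` is null for `P`. -/
def AbsCont (P : FinAddProb Ω) (Q : Measure Ω) : Prop :=
  ∀ E : Set Ω, MeasurableSet E → Q E = 0 → P.content E = 0

/-- Countable additivity of a finitely additive probability measure. -/
def IsCountablyAdditive (P : FinAddProb Ω) : Prop :=
  ∀ E : ℕ → Set Ω, (∀ i, MeasurableSet (E i)) → Pairwise (Function.onFun Disjoint E) →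
    HasSum (fun i => P.content (E i)) (P.content (⋃ i, E i))

/-- A countably additive `P`, regarded as a measure. -/
def toMeasure (P : FinAddProb Ω) (hP : P.IsCountablyAdditive) : Measure Ω :=
  Measure.ofMeasurable (fun s _ => (P.content s : ℝ≥0∞)) (by simp)
    (fun E hE hd => (ENNReal.tsum_coe_eq (hP E hE hd)).symm)

end FinAddProb

/-- The set `B(Ω, Σ)` of all bounded measurable real-valued functions on `Ω`. -/
def boundedMeasurable (Ω : Type*) [MeasurableSpace Ω] : Set (Ω → ℝ) :=
  {h | Measurable h ∧ ∃ C : ℝ, ∀ x, |h x| ≤ C}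

/-- The functions `f : ℝ → (-∞, ∞]` that define an `f`-divergence: convex, lower semicontinuous,
`f 1 = 0`, finite in a neighbourhood of `1`, and `∞` on the negative half-line. -/
structure IsDivergenceFunction (f : ℝ → EReal) : Prop where
  ne_bot : ∀ x, f x ≠ ⊥
  lowerSemicontinuous : LowerSemicontinuous f
  convex : ∀ x y a b : ℝ, 0 < a → 0 < b → a + b = 1 →
    f (a * x + b * y) ≤ (a : EReal) * f x + (b : EReal) * f y
  map_one : f 1 = 0
  finite_near_one : ∀ᶠ x in nhds (1 : ℝ), f x ≠ ⊤
  of_neg : ∀ x < 0, f x = ⊤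

/-- The convex conjugate `f* (s) = sup_x (x s - f x)`. -/
def convexConj (f : ℝ → EReal) (s : ℝ) : EReal :=
  ⨆ x : ℝ, ((x * s : ℝ) : EReal) - f x

/-- The Lebesgue integral of an extended-real-valued function: the integral of the positive part
minus the integral of the negative part. It is applied below only to functions whose negative
part has a finite integral. -/
def erealIntegral {Ω : Type*} [MeasurableSpace Ω] (Q : Measure Ω) (g : Ω → EReal) : EReal :=
  ((∫⁻ x, (g x).toENNReal ∂Q : ℝ≥0∞) : EReal) - ((∫⁻ x, (-g x).toENNReal ∂Q : ℝ≥0∞) : EReal)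

/-- The `f`-divergence `∫ f (dP/dQ) dQ` of measures with `P ≪ Q`. -/
def fDiv {Ω : Type*} [MeasurableSpace Ω] (f : ℝ → EReal) (P Q : Measure Ω) : EReal :=
  erealIntegral Q (fun x => f (P.rnDeriv Q x).toReal)

/-- The restricted `f`-divergence `sup_{h ∈ H} (E_P[h] - E_Q[f* ∘ h])`. -/
def restrictedFDiv {Ω : Type*} [MeasurableSpace Ω] (f : ℝ → EReal) (H : Set (Ω → ℝ))
    (P : FinAddProb Ω) (Q : Measure Ω) : EReal :=
  ⨆ h ∈ H, ((P.expect h : ℝ) : EReal) - erealIntegral Q (fun x => convexConj f (h x))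

open Classical in
/-- The extended `f`-divergence: the `f`-divergence if `P` is countably additive and absolutely
continuous with respect to `Q`, and the variational expression over all bounded measurable
functions otherwise. -/
def extFDiv {Ω : Type*} [MeasurableSpace Ω] (f : ℝ → EReal)
    (P : FinAddProb Ω) (Q : Measure Ω) : EReal :=
  if hP : P.IsCountablyAdditive ∧ P.AbsCont Q then fDiv f (P.toMeasure hP.1) Q
  else restrictedFDiv f (boundedMeasurable Ω) P Q

end

/-! ### Convex analysis of divergence functions -/

/-! For `≤`, add and subtract `E_{P'}[h]` and apply the Fenchel–Young bound `E_{P'}[h] - E_Q[f*(h)]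
≤ D̄_f(P'‖Q)` (`sub_le_extFDiv`).

For `≥`, a single `P' ≪ Q` attains the infimum. Let `D` be the restricted divergence, assumed
finite. An algebraic Hahn–Banach argument (`exists_linearMap_le_of_convex`) gives a linear `L` on
the bounded measurable functions with `L g - L h ≤ E_Q[f*(g)] - E_P[h] + D` for all bounded
measurable `g` and all `h ∈ H`. Invariance of `H` under constants forces `L 1 = 1`. Since `f*` is
monotone, `L v ≤ 0` whenever `v ≤ 0` holds `Q`-a.e. So `L` is the expectation of a finitely additive
`P' ≪ Q` (`exists_absCont_forall_le`). Taking suprema over `g` and `h` gives the claim, provided the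
supremum over `g` dominates `D̄_f(P'‖Q)`.

That last point is the definition, unless `P'` is countably additive; then it is the variational
formula (`fDiv_le_of_forall`), proved by writing `f` as a supremum of countably many affine
minorants and using monotone convergence. A pair `(s, c)` with `f*(s) ≤ c` encodes the minorant `x ↦
x s - c`. -/

theorem convexConj_le_coe_iff {f : ℝ → EReal} {s v : ℝ} :
    convexConj f s ≤ (v : EReal) ↔ ∀ x : ℝ, ((x * s - v : ℝ) : EReal) ≤ f x := by
  unfold convexConj
  rw [iSup_le_iff]
  refine forall_congr' fun x => ?_
  induction f x with
  | bot => simp [-EReal.coe_sub, -EReal.coe_mul]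
  | top => simp
  | coe y =>
    norm_cast
    exact ⟨fun h => by linarith, fun h => by linarith⟩

namespace IsDivergenceFunction

variable {f : ℝ → EReal}

/-- The term `x = 1` of the supremum. For bounded `h` it bounds `f*(h)` below by the integrable
function `h`, so `E_Q[f*(h)]` is never `-∞`. -/
theorem le_convexConj (hf : IsDivergenceFunction f) (s : ℝ) : (s : EReal) ≤ convexConj f s := by
  refine le_trans ?_ (le_iSup (fun x : ℝ => ((x * s : ℝ) : EReal) - f x) 1)
  simp [hf.map_one]

/-- Only `x ≥ 0` contributes, since `f = ∞` on the negative half-line. Positivity and absolute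
continuity of the dual measure come from here. -/
theorem convexConj_mono (hf : IsDivergenceFunction f) : Monotone (convexConj f) := by
  intro s t hst
  refine iSup_le fun x => ?_
  rcases lt_or_ge x 0 with hx | hx
  · simp [hf.of_neg x hx]
  · refine le_trans ?_ (le_iSup (fun x : ℝ => ((x * t : ℝ) : EReal) - f x) x)
    exact EReal.sub_le_sub (EReal.coe_le_coe_iff.2 (by gcongr)) le_rfl

theorem measurable_convexConj (hf : IsDivergenceFunction f) : Measurable (convexConj f) :=
  hf.convexConj_mono.measurable

theorem measurable (hf : IsDivergenceFunction f) : Measurable f :=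
  hf.lowerSemicontinuous.measurable

theorem convexConj_combo_le {s t v w a b : ℝ}
    (hs : convexConj f s ≤ (v : EReal)) (ht : convexConj f t ≤ (w : EReal))
    (ha : 0 ≤ a) (hb : 0 ≤ b) (hab : a + b = 1) :
    convexConj f (a * s + b * t) ≤ ((a * v + b * w : ℝ) : EReal) := by
  rw [convexConj_le_coe_iff] at *
  intro x
  have h1 := hs x
  have h2 := ht x
  generalize f x = y at h1 h2 ⊢
  induction y with
  | bot => simp [-EReal.coe_sub, -EReal.coe_mul] at h1
  | top => simp
  | coe y =>
    norm_cast at *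
    have h3 := mul_le_mul_of_nonneg_left h1 ha
    have h4 := mul_le_mul_of_nonneg_left h2 hb
    have h5 : a * y + b * y = y := by rw [← add_mul, hab, one_mul]
    linarith

theorem convex_epigraph (hf : IsDivergenceFunction f) :
    Convex ℝ {p : ℝ × ℝ | f p.1 ≤ (p.2 : EReal)} := by
  rw [convex_iff_forall_pos]
  rintro ⟨x, v⟩ hx ⟨y, w⟩ hy a b ha hb hab
  simp only [mem_ofPred_eq] at hx hy
  change f (a * x + b * y) ≤ ((a * v + b * w : ℝ) : EReal)
  refine (hf.convex x y a b ha hb hab).trans ?_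
  push_cast
  gcongr

theorem isClosed_epigraph (hf : IsDivergenceFunction f) :
    IsClosed {p : ℝ × ℝ | f p.1 ≤ (p.2 : EReal)} :=
  hf.lowerSemicontinuous.isClosed_epigraph.preimage
    (f := fun p : ℝ × ℝ => (p.1, (p.2 : EReal)))
    (continuous_fst.prodMk (continuous_coe_real_ereal.comp continuous_snd))

/-- Separation of a point from the epigraph. -/
theorem exists_separation (hf : IsDivergenceFunction f) {x y : ℝ} (hy : (y : EReal) < f x) :
    ∃ α β u : ℝ, 0 ≤ β ∧ α * x + β * y < u ∧
      ∀ z w : ℝ, f z ≤ (w : EReal) → u < α * z + β * w := by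
  obtain ⟨φ, u, h1, h2⟩ := geometric_hahn_banach_point_closed hf.convex_epigraph
    hf.isClosed_epigraph (x := (x, y)) (by simpa using hy)
  have hφ : ∀ z w : ℝ, φ (z, w) = φ (1, 0) * z + φ (0, 1) * w := by
    intro z w
    have : ((z, w) : ℝ × ℝ) = z • (1, 0) + w • (0, 1) := by simp
    rw [this, map_add, map_smul, map_smul, smul_eq_mul, smul_eq_mul]
    ring
  refine ⟨φ (1, 0), φ (0, 1), u, ?_, by rw [← hφ]; exact h1, fun z w h => ?_⟩
  · by_contra! hneg
    -- The epigraph contains the upward ray over `1`; a negative last coefficient would push the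
    -- functional below `u` far up that ray.
    obtain ⟨n, hn⟩ := exists_nat_gt ((φ (1, 0) - u) / (-φ (0, 1)))
    have h3 := h2 (1, (n : ℝ)) (by simp [hf.map_one])
    rw [hφ] at h3
    rw [div_lt_iff₀ (by linarith)] at hn
    linarith
  · rw [← hφ]
    exact h2 (z, w) h

theorem minorant_of_separation (hf : IsDivergenceFunction f) {α β u : ℝ} (hβ : 0 < β)
    (h : ∀ z w : ℝ, f z ≤ (w : EReal) → u < α * z + β * w) :
    convexConj f (-α / β) ≤ ((-u / β : ℝ) : EReal) := by
  rw [convexConj_le_coe_iff]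
  intro z
  have hb := hf.ne_bot z
  have h1 := h z
  generalize f z = y at hb h1 ⊢
  induction y with
  | bot => exact absurd rfl hb
  | top => simp
  | coe y =>
    have h2 := h1 y le_rfl
    refine EReal.coe_le_coe_iff.2 ?_
    have : z * (-α / β) - -u / β = (u - α * z) / β := by field_simp; ring
    rw [this, div_le_iff₀ hβ]
    linarith

/-- Separate `(1, -1)` from the epigraph. Comparison with `(1, 0)`, which lies in it, shows that the
hyperplane is not vertical. -/
theorem exists_convexConj_le (hf : IsDivergenceFunction f) :
    ∃ s c : ℝ, convexConj f s ≤ (c : EReal) := by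
  obtain ⟨α, β, u, hβ, h1, h2⟩ := hf.exists_separation (x := 1) (y := -1)
    (by rw [hf.map_one]; exact_mod_cast neg_one_lt_zero)
  have h3 := h2 1 0 (by simp [hf.map_one])
  exact ⟨_, _, hf.minorant_of_separation (by nlinarith) h2⟩

/-- Every value below `f x` is exceeded at `x` by an affine minorant of `f`. -/
theorem exists_minorant_gt (hf : IsDivergenceFunction f) {x y : ℝ} (hy : (y : EReal) < f x) :
    ∃ s c : ℝ, convexConj f s ≤ (c : EReal) ∧ y < x * s - c := by
  obtain ⟨α, β, u, hβ, h1, h2⟩ := hf.exists_separation hy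
  rcases hβ.lt_or_eq with hβ | rfl
  · refine ⟨_, _, hf.minorant_of_separation hβ h2, ?_⟩
    have : x * (-α / β) - -u / β = (u - α * x) / β := by field_simp; ring
    rw [this, lt_div_iff₀ hβ]
    linarith
  -- Vertical hyperplane: add `k (u - α z)` to a known minorant. This term is negative wherever `f`
  -- is finite, so the sum is still a minorant, and it is as large as desired at `x`.
  · obtain ⟨s, c, hsc⟩ := hf.exists_convexConj_le
    simp only [zero_mul, add_zero] at h1 h2
    obtain ⟨k, hk⟩ := exists_nat_gt ((y - (x * s - c)) / (u - α * x))
    rw [div_lt_iff₀ (by linarith)] at hk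
    refine ⟨s - k * α, c - k * u, ?_, by linarith⟩
    rw [convexConj_le_coe_iff] at *
    intro z
    have hb := hf.ne_bot z
    have h3 := h2 z
    have h4 := hsc z
    generalize f z = w at hb h3 h4 ⊢
    induction w with
    | bot => exact absurd rfl hb
    | top => simp
    | coe w =>
      have h5 := h3 w le_rfl
      norm_cast at *
      have : (0 : ℝ) ≤ k := k.cast_nonneg
      nlinarith

/-- A divergence function is the supremum of countably many affine minorants. -/
theorem exists_countable_minorants (hf : IsDivergenceFunction f) :
    ∃ s c : ℕ → ℝ, (∀ n, convexConj f (s n) ≤ (c n : EReal)) ∧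
      ∀ x, f x ≤ ⨆ n, ((x * s n - c n : ℝ) : EReal) := by
  let ι := {p : ℝ × ℝ // convexConj f p.1 ≤ (p.2 : EReal)}
  -- Lindelöf: for each rational `q`, countably many minorants already cover the set where some
  -- minorant exceeds `q`.
  have hex : ∀ q : ℚ, ∃ T : Set ι, T.Countable ∧
      ⋃ i ∈ T, {x : ℝ | (q : ℝ) < x * i.1.1 - i.1.2} =
        ⋃ i : ι, {x : ℝ | (q : ℝ) < x * i.1.1 - i.1.2} := fun q =>
    TopologicalSpace.isOpen_iUnion_countable _ fun i =>
      isOpen_lt continuous_const (by fun_prop)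
  choose T hTc hT using hex
  obtain ⟨s₀, c₀, h₀⟩ := hf.exists_convexConj_le
  have hc : (insert (⟨(s₀, c₀), h₀⟩ : ι) (⋃ q, T q)).Countable :=
    (countable_iUnion hTc).insert _
  obtain ⟨g, hg⟩ := hc.exists_eq_range (insert_nonempty _ _)
  refine ⟨fun n => (g n).1.1, fun n => (g n).1.2, fun n => (g n).2, fun x => ?_⟩
  refine le_of_forall_lt fun y hy => ?_
  obtain ⟨q, hq1, hq2⟩ := EReal.exists_rat_btwn_of_lt hy
  obtain ⟨s, c, hsc, hlt⟩ := hf.exists_minorant_gt (x := x) (y := q) hq2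
  have hx : x ∈ ⋃ i ∈ T q, {x : ℝ | (q : ℝ) < x * i.1.1 - i.1.2} := by
    rw [hT]
    exact mem_iUnion.2 ⟨⟨(s, c), hsc⟩, hlt⟩
  simp only [mem_iUnion] at hx
  obtain ⟨i, hi, hxi⟩ := hx
  obtain ⟨n, hn⟩ : i ∈ range g := hg ▸ mem_insert_of_mem _ (mem_iUnion.2 ⟨q, hi⟩)
  refine hq1.trans (lt_of_lt_of_le ?_ (le_iSup _ n))
  subst hn
  exact EReal.coe_lt_coe_iff.2 hxi

end IsDivergenceFunction

/-! ### The integral of extended-real-valued functions -/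

section erealIntegral

variable {Ω : Type*} [MeasurableSpace Ω] {Q : Measure Ω}

theorem erealIntegral_mono_ae {u v : Ω → EReal} (h : u ≤ᵐ[Q] v) :
    erealIntegral Q u ≤ erealIntegral Q v := by
  refine EReal.sub_le_sub (EReal.coe_ennreal_le_coe_ennreal_iff.2 (lintegral_mono_ae ?_))
    (EReal.coe_ennreal_le_coe_ennreal_iff.2 (lintegral_mono_ae ?_))
  · filter_upwards [h] with x hx using EReal.toENNReal_le_toENNReal hx
  · filter_upwards [h] with x hx using EReal.toENNReal_le_toENNReal (EReal.neg_le_neg_iff.2 hx)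

theorem erealIntegral_coe {v : Ω → ℝ} (hv : Integrable v Q) :
    erealIntegral Q (fun x => (v x : EReal)) = ((∫ x, v x ∂Q : ℝ) : EReal) := by
  have h1 : ∫⁻ x, ENNReal.ofReal (v x) ∂Q ≠ ⊤ := hv.lintegral_lt_top.ne
  have h2 : ∫⁻ x, ENNReal.ofReal (-v x) ∂Q ≠ ⊤ := hv.neg.lintegral_lt_top.ne
  rw [integral_eq_lintegral_pos_part_sub_lintegral_neg_part hv, EReal.coe_sub]
  unfold erealIntegral
  simp_rw [← EReal.coe_neg, EReal.real_coe_toENNReal]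
  rw [← EReal.coe_ennreal_toReal h1, ← EReal.coe_ennreal_toReal h2]

theorem erealIntegral_congr_ae {u v : Ω → EReal} (h : u =ᵐ[Q] v) :
    erealIntegral Q u = erealIntegral Q v :=
  le_antisymm (erealIntegral_mono_ae h.le) (erealIntegral_mono_ae h.symm.le)

/-- The minorant `w` makes the negative part integrable, so a value other than `⊤` makes the
positive part integrable too. -/
theorem exists_integrable_of_erealIntegral_ne_top {u : Ω → EReal} (hu : Measurable u)
    {w : Ω → ℝ} (hw : Integrable w Q) (hwu : ∀ x, (w x : EReal) ≤ u x)
    (h : erealIntegral Q u ≠ ⊤) :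
    ∃ v : Ω → ℝ, Integrable v Q ∧ u =ᵐ[Q] fun x => (v x : EReal) := by
  have hneg : ∫⁻ x, (-u x).toENNReal ∂Q ≠ ⊤ := by
    refine ((lintegral_mono fun x => ?_).trans_lt hw.neg.lintegral_lt_top).ne
    exact EReal.toENNReal_le_toENNReal (y := ((-w x : ℝ) : EReal))
      (by rw [EReal.coe_neg]; exact EReal.neg_le_neg_iff.2 (hwu x))
  have hpos : ∫⁻ x, (u x).toENNReal ∂Q ≠ ⊤ := by
    intro htop
    apply h
    unfold erealIntegral
    rw [htop, EReal.coe_ennreal_top]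
    exact EReal.top_sub (by simpa using hneg)
  refine ⟨fun x => (u x).toReal, ⟨hu.ereal_toReal.aestronglyMeasurable, ?_⟩, ?_⟩
  · refine (lintegral_mono (g := fun x => (u x).toENNReal + (-u x).toENNReal) fun x => ?_).trans_lt
      ?_
    · simp only
      generalize u x = y
      induction y with
      | bot => simp
      | top => simp
      | coe y =>
        rw [← EReal.coe_neg, EReal.toReal_coe, EReal.real_coe_toENNReal, EReal.real_coe_toENNReal,
          Real.enorm_eq_ofReal_abs]
        rcases le_total 0 y with hy | hy
        · rw [abs_of_nonneg hy]; exact le_self_add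
        · rw [abs_of_nonpos hy]; exact le_add_self
    · rw [lintegral_add_left hu.ereal_toENNReal]
      exact ENNReal.add_lt_top.2 ⟨hpos.lt_top, hneg.lt_top⟩
  · filter_upwards [ae_lt_top hu.ereal_toENNReal hpos] with x hx
    rw [EReal.coe_toReal (EReal.toENNReal_ne_top_iff.1 hx.ne)]
    intro hb
    simpa [hb] using hwu x

/-- Monotone convergence, as an upper bound. -/
theorem erealIntegral_le_of_le_iSup {u : Ω → EReal} (hu : Measurable u) {φ : ℕ → Ω → ℝ}
    (hφm : ∀ n, Measurable (φ n)) (hφ : ∀ n, Integrable (φ n) Q) (hmono : Monotone φ)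
    (h0 : ∀ x, (φ 0 x : EReal) ≤ u x)
    (hsup : ∀ x, u x ≤ ⨆ n, (φ n x : EReal)) {M : ℝ} (hM : ∀ n, ∫ x, φ n x ∂Q ≤ M) :
    erealIntegral Q u ≤ (M : EReal) := by
  -- Subtracting `φ 0` makes all functions nonnegative, so that monotone convergence for `lintegral`
  -- applies; finiteness of `u` a.e. is a consequence.
  have hψ : ∀ n, Integrable (fun x => φ n x - φ 0 x) Q := fun n => (hφ n).sub (hφ 0)
  have hle : ∫⁻ x, (u x - φ 0 x).toENNReal ∂Q ≤ ENNReal.ofReal (M - ∫ x, φ 0 x ∂Q) := by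
    have hpt : ∀ x, (u x - φ 0 x).toENNReal ≤ ⨆ n, ENNReal.ofReal (φ n x - φ 0 x) := by
      intro x
      refine le_of_forall_lt fun y hy => ?_
      lift y to ℝ≥0 using hy.ne_top
      have hy' : ((y : ℝ) : EReal) < u x - φ 0 x := by
        by_contra! hcon
        have := EReal.toENNReal_le_toENNReal hcon
        rw [EReal.real_coe_toENNReal, ENNReal.ofReal_coe_nnreal] at this
        exact absurd hy this.not_gt
      have h3 := (EReal.add_lt_of_lt_sub hy').trans_le (hsup x)
      obtain ⟨n, hn⟩ := lt_iSup_iff.1 h3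
      refine lt_of_lt_of_le ?_ (le_iSup _ n)
      norm_cast at hn
      rw [← ENNReal.ofReal_coe_nnreal]
      exact (ENNReal.ofReal_lt_ofReal_iff_of_nonneg y.2).2 (lt_sub_iff_add_lt.2 hn)
    refine (lintegral_mono hpt).trans ?_
    rw [lintegral_iSup (f := fun n x => ENNReal.ofReal (φ n x - φ 0 x))
      (fun n => ((hφm n).sub (hφm 0)).ennreal_ofReal)]
    · refine iSup_le fun n => ?_
      rw [← ofReal_integral_eq_lintegral_ofReal (hψ n)
        (Filter.Eventually.of_forall fun x => sub_nonneg.2 (hmono (Nat.zero_le n) x))]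
      refine ENNReal.ofReal_le_ofReal ?_
      rw [integral_sub (hφ n) (hφ 0)]
      linarith [hM n]
    · intro m n hmn x
      exact ENNReal.ofReal_le_ofReal (by linarith [hmono hmn x])
  have hmeas : Measurable fun x => u x - φ 0 x := hu.sub (hφm 0).coe_real_ereal
  have hfin : ∀ᵐ x ∂Q, (u x - φ 0 x).toENNReal < ⊤ :=
    ae_lt_top hmeas.ereal_toENNReal (hle.trans_lt ENNReal.ofReal_lt_top).ne
  have hae : u =ᵐ[Q] fun x => ((u x).toReal : EReal) := by
    filter_upwards [hfin] with x hx
    rw [EReal.coe_toReal]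
    · rintro h
      rw [h, EReal.top_sub_coe] at hx
      simp at hx
    · intro hb
      simpa [hb] using h0 x
  have hnn : ∀ᵐ x ∂Q, 0 ≤ (u x).toReal - φ 0 x := by
    filter_upwards [hae] with x hx
    have := h0 x
    rw [hx] at this
    exact sub_nonneg.2 (EReal.coe_le_coe_iff.1 this)
  have hle' : ∫⁻ x, ENNReal.ofReal ((u x).toReal - φ 0 x) ∂Q ≤
      ENNReal.ofReal (M - ∫ x, φ 0 x ∂Q) := by
    refine (lintegral_congr_ae ?_).trans_le hle
    filter_upwards [hae] with x hx
    conv_rhs => rw [hx, ← EReal.coe_sub, EReal.real_coe_toENNReal]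
  have hint : Integrable (fun x => (u x).toReal - φ 0 x) Q := by
    refine ⟨(hu.ereal_toReal.sub (hφm 0)).aestronglyMeasurable, ?_⟩
    rw [hasFiniteIntegral_iff_ofReal hnn]
    exact hle'.trans_lt ENNReal.ofReal_lt_top
  have hint' : Integrable (fun x => (u x).toReal) Q := by
    exact (hint.add (hφ 0)).congr (Filter.Eventually.of_forall fun x => sub_add_cancel _ _)
  rw [erealIntegral_congr_ae hae, erealIntegral_coe hint', EReal.coe_le_coe_iff]
  rw [← ofReal_integral_eq_lintegral_ofReal hint hnn,
    ENNReal.ofReal_le_ofReal_iff (by linarith [hM 0]), integral_sub hint' (hφ 0)] at hle'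
  linarith

end erealIntegral

/-! ### Integration against finitely additive probability measures -/

section

variable {Ω : Type*} [MeasurableSpace Ω]

/-- The bounded measurable functions as a real vector space. -/
def boundedMeasurableSubmodule (Ω : Type*) [MeasurableSpace Ω] : Submodule ℝ (Ω → ℝ) where
  carrier := boundedMeasurable Ω
  zero_mem' := ⟨measurable_const, 0, by simp⟩
  add_mem' := by
    rintro g h ⟨hg, C, hC⟩ ⟨hh, D, hD⟩
    exact ⟨hg.add hh, C + D, fun x => (abs_add_le _ _).trans (add_le_add (hC x) (hD x))⟩
  smul_mem' := by
    rintro c h ⟨hh, C, hC⟩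
    refine ⟨hh.const_smul c, |c| * C, fun x => ?_⟩
    rw [Pi.smul_apply, smul_eq_mul, abs_mul]
    exact mul_le_mul_of_nonneg_left (hC x) (abs_nonneg c)

theorem const_mem_boundedMeasurable (c : ℝ) : (fun _ => c) ∈ boundedMeasurable Ω :=
  ⟨measurable_const, |c|, fun _ => le_rfl⟩

theorem indicator_mem_boundedMeasurable {E : Set Ω} (hE : MeasurableSet E) :
    E.indicator (fun _ => (1 : ℝ)) ∈ boundedMeasurable Ω := by
  refine ⟨measurable_const.indicator hE, 1, fun x => ?_⟩
  by_cases hx : x ∈ E <;> simp [hx]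

theorem simpleFunc_mem_boundedMeasurable (s : SimpleFunc Ω ℝ) :
    (s : Ω → ℝ) ∈ boundedMeasurable Ω := by
  obtain ⟨C, hC⟩ := s.exists_forall_norm_le
  exact ⟨s.measurable, C, hC⟩

/-- Uniform approximation of a bounded measurable function from below by simple functions. -/
theorem exists_simpleFunc_le_le_add {h : Ω → ℝ} (hh : h ∈ boundedMeasurable Ω) {ε : ℝ}
    (hε : 0 < ε) : ∃ s : SimpleFunc Ω ℝ, (∀ x, s x ≤ h x) ∧ ∀ x, h x ≤ s x + ε := by
  obtain ⟨hm, C, hC⟩ := hh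
  have hmeas : Measurable fun x => ε * (⌊h x / ε⌋ : ℝ) := by
    have h1 : Measurable fun x => ⌊h x / ε⌋ := (hm.div_const ε).floor
    have h2 : Measurable fun n : ℤ => ε * (n : ℝ) := measurable_from_top
    exact h2.comp h1
  refine ⟨⟨fun x => ε * (⌊h x / ε⌋ : ℝ), fun c => hmeas (measurableSet_singleton c), ?_⟩,
    fun x => ?_, fun x => ?_⟩
  · refine ((finite_Icc ⌊-C / ε⌋ ⌊C / ε⌋).image fun n : ℤ => ε * (n : ℝ)).subset ?_
    rintro _ ⟨x, rfl⟩
    refine ⟨⌊h x / ε⌋, ⟨Int.floor_mono ?_, Int.floor_mono ?_⟩, rfl⟩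
    · exact div_le_div_of_nonneg_right (abs_le.1 (hC x)).1 hε.le
    · exact div_le_div_of_nonneg_right (abs_le.1 (hC x)).2 hε.le
  · change ε * (⌊h x / ε⌋ : ℝ) ≤ h x
    have := Int.floor_le (h x / ε)
    rw [le_div_iff₀ hε] at this
    linarith
  · change h x ≤ ε * (⌊h x / ε⌋ : ℝ) + ε
    have := (Int.lt_floor_add_one (h x / ε)).le
    rw [div_le_iff₀ hε] at this
    linarith

namespace FinAddProb

variable (P : FinAddProb Ω)

theorem content_union {s t : Set Ω} (hs : MeasurableSet s) (ht : MeasurableSet t)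
    (hst : Disjoint s t) : P.content (s ∪ t) = P.content s + P.content t :=
  addContent_union' hs ht (hs.union ht) hst

/-- The integral of a simple function. -/
noncomputable def simpleExpect (s : SimpleFunc Ω ℝ) : ℝ :=
  ∑ c ∈ s.range, c * (P.content (s ⁻¹' {c}) : ℝ)

theorem simpleExpect_eq_setToSimpleFunc (s : SimpleFunc Ω ℝ) :
    P.simpleExpect s = SimpleFunc.setToSimpleFunc
      (fun E => (P.content E : ℝ) • ContinuousLinearMap.id ℝ ℝ) s := by
  unfold simpleExpect SimpleFunc.setToSimpleFunc
  exact Finset.sum_congr rfl fun c _ => by simp [mul_comm]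

/-- The reference measure `0` makes all finiteness and integrability side conditions trivial, so
only additivity of `P` is needed. -/
theorem finMeasAdditive : FinMeasAdditive (0 : Measure Ω)
    (fun E => (P.content E : ℝ) • ContinuousLinearMap.id ℝ ℝ) := by
  intro s t hs ht _ _ hst
  simp only [P.content_union hs ht hst, NNReal.coe_add, add_smul]

theorem simpleExpect_add (s t : SimpleFunc Ω ℝ) :
    P.simpleExpect (s + t) = P.simpleExpect s + P.simpleExpect t := by
  simp only [simpleExpect_eq_setToSimpleFunc]
  exact SimpleFunc.setToSimpleFunc_add _ P.finMeasAdditive integrable_zero_measure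
    integrable_zero_measure

theorem simpleExpect_smul (c : ℝ) (s : SimpleFunc Ω ℝ) :
    P.simpleExpect (c • s) = c * P.simpleExpect s := by
  simp only [simpleExpect_eq_setToSimpleFunc]
  exact SimpleFunc.setToSimpleFunc_smul_real _ P.finMeasAdditive c integrable_zero_measure

theorem nonempty (P : FinAddProb Ω) : Nonempty Ω := by
  by_contra hΩ
  rw [not_nonempty_iff] at hΩ
  have h := P.content_univ
  rw [univ_eq_empty_iff.2 hΩ, addContent_empty] at h
  exact zero_ne_one h

theorem simpleExpect_const (c : ℝ) : P.simpleExpect (SimpleFunc.const Ω c) = c := by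
  have := P.nonempty
  have h : Function.const Ω c ⁻¹' {c} = univ := eq_univ_of_forall fun _ => rfl
  simp [simpleExpect, h, P.content_univ]

theorem simpleExpect_mono {s t : SimpleFunc Ω ℝ} (hst : ∀ x, s x ≤ t x) :
    P.simpleExpect s ≤ P.simpleExpect t := by
  have h1 : t = s + (t + (-1 : ℝ) • s) := by
    ext x
    simp
  have h2 : 0 ≤ P.simpleExpect (t + (-1 : ℝ) • s) := by
    refine Finset.sum_nonneg fun c hc => mul_nonneg ?_ NNReal.zero_le_coe
    obtain ⟨x, rfl⟩ := SimpleFunc.mem_range.1 hc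
    simpa using hst x
  rw [h1, simpleExpect_add]
  linarith

variable {h g : Ω → ℝ}

theorem simpleExpect_le_expect (hh : h ∈ boundedMeasurable Ω) {s : SimpleFunc Ω ℝ}
    (hs : ∀ x, s x ≤ h x) : P.simpleExpect s ≤ P.expect h := by
  obtain ⟨-, C, hC⟩ := hh
  refine le_ciSup (f := fun s : {s : SimpleFunc Ω ℝ // ∀ x, s x ≤ h x} => P.simpleExpect s.1)
    ⟨C, ?_⟩ ⟨s, hs⟩
  rintro _ ⟨t, rfl⟩
  rw [← P.simpleExpect_const C]
  exact P.simpleExpect_mono fun x => (t.2 x).trans (abs_le.1 (hC x)).2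

theorem expect_le_simpleExpect (hh : h ∈ boundedMeasurable Ω) {s : SimpleFunc Ω ℝ}
    (hs : ∀ x, h x ≤ s x) : P.expect h ≤ P.simpleExpect s := by
  obtain ⟨-, C, hC⟩ := hh
  have : Nonempty {s : SimpleFunc Ω ℝ // ∀ x, s x ≤ h x} :=
    ⟨SimpleFunc.const Ω (-C), fun x => (abs_le.1 (hC x)).1⟩
  exact ciSup_le fun t => P.simpleExpect_mono fun x => (t.2 x).trans (hs x)

/-- Lower and upper integrals agree: `s ≤ h ≤ s + ε` with `s` simple, and the two bounds differ by
`ε`. -/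
theorem expect_eq_of_forall (hh : h ∈ boundedMeasurable Ω) {y : ℝ}
    (h1 : ∀ s : SimpleFunc Ω ℝ, (∀ x, s x ≤ h x) → P.simpleExpect s ≤ y)
    (h2 : ∀ s : SimpleFunc Ω ℝ, (∀ x, h x ≤ s x) → y ≤ P.simpleExpect s) : P.expect h = y := by
  refine le_antisymm ?_ ?_ <;> refine le_of_forall_pos_le_add fun ε hε => ?_ <;>
    obtain ⟨s, hs, hs'⟩ := exists_simpleFunc_le_le_add hh hε
  · have h3 := P.expect_le_simpleExpect hh (s := s + SimpleFunc.const Ω ε) hs'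
    rw [simpleExpect_add, simpleExpect_const] at h3
    linarith [h1 s hs]
  · have h3 := h2 (s + SimpleFunc.const Ω ε) hs'
    rw [simpleExpect_add, simpleExpect_const] at h3
    linarith [P.simpleExpect_le_expect hh hs]

/-- A functional on bounded measurable functions that is monotone and integrates simple functions
correctly is the expectation. -/
theorem expect_eq_of_monotone {L : (Ω → ℝ) → ℝ}
    (hL : ∀ f ∈ boundedMeasurable Ω, ∀ g ∈ boundedMeasurable Ω, (∀ x, f x ≤ g x) → L f ≤ L g)
    (hs : ∀ s : SimpleFunc Ω ℝ, L s = P.simpleExpect s) (hh : h ∈ boundedMeasurable Ω) :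
    P.expect h = L h :=
  P.expect_eq_of_forall hh
    (fun s hsh => hs s ▸ hL _ (simpleFunc_mem_boundedMeasurable s) _ hh hsh)
    (fun s hsh => hs s ▸ hL _ hh _ (simpleFunc_mem_boundedMeasurable s) hsh)

/-- For nonnegative coefficients, approximations from below combine to approximations from below.
Convex combinations and shifts by constants require no more. -/
theorem expect_combo (hh : h ∈ boundedMeasurable Ω) (hg : g ∈ boundedMeasurable Ω) {a b : ℝ}
    (ha : 0 ≤ a) (hb : 0 ≤ b) :
    P.expect (a • h + b • g) = a * P.expect h + b * P.expect g := by
  have hmem : a • h + b • g ∈ boundedMeasurable Ω :=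
    (boundedMeasurableSubmodule Ω).add_mem
      ((boundedMeasurableSubmodule Ω).smul_mem a hh) ((boundedMeasurableSubmodule Ω).smul_mem b hg)
  have key : ∀ ε > 0, |P.expect (a • h + b • g) - (a * P.expect h + b * P.expect g)| ≤
      (a + b) * ε := by
    intro ε hε
    obtain ⟨s, hs, hs'⟩ := exists_simpleFunc_le_le_add hh hε
    obtain ⟨t, ht, ht'⟩ := exists_simpleFunc_le_le_add hg hε
    have h1 := P.simpleExpect_le_expect hmem (s := a • s + b • t) fun x =>
      add_le_add (mul_le_mul_of_nonneg_left (hs x) ha) (mul_le_mul_of_nonneg_left (ht x) hb)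
    have h2 := P.expect_le_simpleExpect hmem
      (s := a • (s + SimpleFunc.const Ω ε) + b • (t + SimpleFunc.const Ω ε)) fun x =>
      add_le_add (mul_le_mul_of_nonneg_left (hs' x) ha) (mul_le_mul_of_nonneg_left (ht' x) hb)
    have h3 := P.expect_le_simpleExpect hh (s := s + SimpleFunc.const Ω ε) hs'
    have h4 := P.expect_le_simpleExpect hg (s := t + SimpleFunc.const Ω ε) ht'
    simp only [simpleExpect_add, simpleExpect_smul, simpleExpect_const] at h1 h2 h3 h4
    have h5 := mul_le_mul_of_nonneg_left (P.simpleExpect_le_expect hh hs) ha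
    have h6 := mul_le_mul_of_nonneg_left (P.simpleExpect_le_expect hg ht) hb
    have h7 := mul_le_mul_of_nonneg_left h3 ha
    have h8 := mul_le_mul_of_nonneg_left h4 hb
    rw [abs_le]
    constructor <;> linarith
  have hle : |P.expect (a • h + b • g) - (a * P.expect h + b * P.expect g)| ≤ 0 := by
    refine le_of_forall_pos_le_add fun δ hδ => ?_
    have hab : 0 < a + b + 1 := by linarith
    refine (key (δ / (a + b + 1)) (div_pos hδ hab)).trans ?_
    rw [zero_add, mul_div_assoc', div_le_iff₀ hab]
    nlinarith
  linarith [abs_eq_zero.1 (le_antisymm hle (abs_nonneg _))]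

theorem expect_const (c : ℝ) : P.expect (fun _ => c) = c :=
  P.expect_eq_of_forall (const_mem_boundedMeasurable c)
    (fun _ hs => (P.simpleExpect_mono (t := SimpleFunc.const Ω c) hs).trans
      (P.simpleExpect_const c).le)
    (fun _ hs => (P.simpleExpect_const c).ge.trans
      (P.simpleExpect_mono (s := SimpleFunc.const Ω c) hs))

theorem expect_add_const (hh : h ∈ boundedMeasurable Ω) (b : ℝ) :
    P.expect (fun x => h x + b) = P.expect h + b := by
  have h1 := P.expect_combo hh (const_mem_boundedMeasurable b) zero_le_one zero_le_one
  simp only [one_smul, one_mul, expect_const] at h1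
  exact h1

/-- A finitely additive probability measure from an additive set function. -/
noncomputable def ofSetFunction (m : Set Ω → ℝ≥0) (h0 : m ∅ = 0)
    (hadd : ∀ s t, MeasurableSet s → MeasurableSet t → Disjoint s t → m (s ∪ t) = m s + m t)
    (h1 : m univ = 1) : FinAddProb Ω where
  content := IsSetRing.addContent_of_union m
    { empty_mem := MeasurableSet.empty
      union_mem := fun _ _ hs ht => MeasurableSet.union hs ht
      sdiff_mem := fun _ _ hs ht => MeasurableSet.diff hs ht } h0
    (fun hs ht hst => hadd _ _ hs ht hst)
  content_univ := h1

/-- A probability measure, regarded as a finitely additive one. -/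
noncomputable def ofMeasure (Q : Measure Ω) [IsProbabilityMeasure Q] : FinAddProb Ω :=
  ofSetFunction (fun s => (Q s).toNNReal) (by simp)
    (fun s t _ ht hst => by
      rw [measure_union hst ht, ENNReal.toNNReal_add (measure_ne_top _ _) (measure_ne_top _ _)])
    (by simp)

theorem absCont_ofMeasure (Q : Measure Ω) [IsProbabilityMeasure Q] : (ofMeasure Q).AbsCont Q :=
  fun E _ h0 => by
    change (Q E).toNNReal = 0
    simp [h0]

/-- The finitely additive probability measure that represents a positive normalised linear
functional on the bounded measurable functions. -/
theorem exists_expect_eq (L : boundedMeasurableSubmodule Ω →ₗ[ℝ] ℝ)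
    (hpos : ∀ v, (∀ x, 0 ≤ v.1 x) → 0 ≤ L v)
    (hone : L ⟨fun _ => 1, const_mem_boundedMeasurable 1⟩ = 1) :
    ∃ P : FinAddProb Ω, (∀ v, P.expect v.1 = L v) ∧
      ∀ (E : Set Ω) (hE : MeasurableSet E),
        (P.content E : ℝ) = L ⟨_, indicator_mem_boundedMeasurable hE⟩ := by
  classical
  let m : Set Ω → ℝ≥0 := fun E =>
    if hE : MeasurableSet E then (L ⟨_, indicator_mem_boundedMeasurable hE⟩).toNNReal else 0
  have hm : ∀ (E : Set Ω) (hE : MeasurableSet E),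
      (m E : ℝ) = L ⟨_, indicator_mem_boundedMeasurable hE⟩ := by
    intro E hE
    simp only [m, dif_pos hE]
    exact Real.coe_toNNReal _ (hpos _ fun x => indicator_nonneg (fun _ _ => zero_le_one) x)
  have h0 : m ∅ = 0 := by
    rw [← NNReal.coe_inj, hm ∅ MeasurableSet.empty, NNReal.coe_zero, ← map_zero L]
    congr 1
    ext x
    simp
  have hadd : ∀ s t, MeasurableSet s → MeasurableSet t → Disjoint s t →
      m (s ∪ t) = m s + m t := by
    intro s t hs ht hst
    rw [← NNReal.coe_inj, NNReal.coe_add, hm _ (hs.union ht), hm _ hs, hm _ ht, ← map_add]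
    congr 1
    ext x
    simp [indicator_union_of_disjoint hst]
  have huniv : m univ = 1 := by
    rw [← NNReal.coe_inj, hm _ MeasurableSet.univ, NNReal.coe_one]
    refine (congrArg L (Subtype.ext ?_)).trans hone
    simp
  let P : FinAddProb Ω := ofSetFunction m h0 hadd huniv
  refine ⟨P, fun v => ?_, hm⟩
  -- `expect_eq_of_monotone` takes a functional of all functions; the value `0` off the bounded
  -- measurable ones is never used.
  let L' : (Ω → ℝ) → ℝ := fun h =>
    if hh : h ∈ boundedMeasurable Ω then L ⟨h, hh⟩ else 0
  have hL' : ∀ (h : Ω → ℝ) (hh : h ∈ boundedMeasurable Ω), L' h = L ⟨h, hh⟩ :=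
    fun h hh => dif_pos hh
  rw [P.expect_eq_of_monotone (L := L') ?_ ?_ v.2, hL' _ v.2]
  · intro f hf g hg hfg
    rw [hL' f hf, hL' g hg, ← sub_nonneg, ← map_sub]
    exact hpos _ fun x => sub_nonneg.2 (hfg x)
  · intro s
    rw [hL' s (simpleFunc_mem_boundedMeasurable s)]
    have hsum : (⟨s, simpleFunc_mem_boundedMeasurable s⟩ : boundedMeasurableSubmodule Ω) =
        ∑ c ∈ s.range, c • ⟨_, indicator_mem_boundedMeasurable (s.measurableSet_fiber c)⟩ := by
      ext x
      rw [Submodule.coe_sum, Finset.sum_apply, Finset.sum_eq_single (s x)]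
      · simp
      · intro c _ hc
        simp [hc.symm]
      · intro hx
        exact absurd (s.mem_range_self x) hx
    rw [hsum, map_sum]
    refine Finset.sum_congr rfl fun c _ => ?_
    rw [map_smul, smul_eq_mul, ← hm _ (s.measurableSet_fiber c)]
    rfl

variable {P}

theorem toMeasure_apply (hP : P.IsCountablyAdditive) {E : Set Ω} (hE : MeasurableSet E) :
    P.toMeasure hP E = P.content E :=
  Measure.ofMeasurable_apply E hE

theorem isProbabilityMeasure_toMeasure (hP : P.IsCountablyAdditive) :
    IsProbabilityMeasure (P.toMeasure hP) :=
  ⟨by rw [toMeasure_apply hP MeasurableSet.univ, P.content_univ, ENNReal.coe_one]⟩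

theorem toMeasure_absolutelyContinuous (hP : P.IsCountablyAdditive) {Q : Measure Ω}
    (hPQ : P.AbsCont Q) : P.toMeasure hP ≪ Q := by
  refine Measure.AbsolutelyContinuous.mk fun E hE h0 => ?_
  rw [toMeasure_apply hP hE, hPQ E hE h0, ENNReal.coe_zero]

theorem integrable_of_mem_boundedMeasurable {μ : Measure Ω} [IsFiniteMeasure μ]
    (hh : h ∈ boundedMeasurable Ω) : Integrable h μ := by
  obtain ⟨hm, C, hC⟩ := hh
  exact Integrable.of_bound hm.aestronglyMeasurable C (Filter.Eventually.of_forall hC)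

theorem expect_eq_integral (hP : P.IsCountablyAdditive) (hh : h ∈ boundedMeasurable Ω) :
    P.expect h = ∫ x, h x ∂P.toMeasure hP := by
  have := isProbabilityMeasure_toMeasure hP
  refine P.expect_eq_of_monotone (L := fun h => ∫ x, h x ∂P.toMeasure hP) ?_ ?_ hh
  · intro f hf g hg hfg
    exact integral_mono (integrable_of_mem_boundedMeasurable hf)
      (integrable_of_mem_boundedMeasurable hg) hfg
  · intro s
    rw [← SimpleFunc.integral_eq_integral _
      (integrable_of_mem_boundedMeasurable (simpleFunc_mem_boundedMeasurable s)),
      SimpleFunc.integral_eq]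
    refine Finset.sum_congr rfl fun c _ => ?_
    rw [smul_eq_mul, mul_comm, measureReal_def, toMeasure_apply hP (s.measurableSet_fiber c),
      ENNReal.coe_toReal]

end FinAddProb

end

/-! ### A separation theorem -/

open scoped Pointwise in
/-- A convex subset of `E × ℝ` that projects onto `E` and whose fibre over `0` is nonnegative lies
above the graph of a linear functional. -/
theorem exists_linearMap_le_of_convex {E : Type*} [AddCommGroup E] [Module ℝ E] {C : Set (E × ℝ)}
    (hC : Convex ℝ C) (h0 : ∀ r, ((0 : E), r) ∈ C → 0 ≤ r) (hproj : ∀ v, ∃ r, (v, r) ∈ C) :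
    ∃ L : E →ₗ[ℝ] ℝ, ∀ v r, (v, r) ∈ C → L v ≤ r := by
  -- The fibre over `v` of the cone generated by `C`. Its infimum is a sublinear function of `v`,
  -- and Hahn–Banach is applied to it starting from the zero subspace.
  let S : E → Set ℝ := fun v => {y | ∃ t : ℝ, 0 < t ∧ (t • v, t * y) ∈ C}
  have hmem : ∀ v r, (v, r) ∈ C → r ∈ S v := fun v r h => ⟨1, one_pos, by simpa using h⟩
  have hne : ∀ v, (S v).Nonempty := fun v => (hproj v).imp fun r hr => hmem v r hr
  have hadd : ∀ v w y z, y ∈ S v → z ∈ S w → y + z ∈ S (v + w) := by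
    rintro v w y z ⟨t, ht, hty⟩ ⟨s, hs, hsz⟩
    have hts : 0 < t + s := add_pos ht hs
    -- The weights `s / (t + s)` and `t / (t + s)` bring both points to the common scale `t s / (t +
    -- s)`.
    refine ⟨t * s / (t + s), by positivity, ?_⟩
    have := hC hty hsz (a := s / (t + s)) (b := t / (t + s)) (by positivity) (by positivity)
      (by field_simp; ring)
    convert this using 1
    ext
    · simp only [Prod.fst_add, Prod.smul_fst, smul_smul, smul_add]
      congr 2 <;> ring
    · simp only [Prod.snd_add, Prod.smul_snd, smul_eq_mul]
      ring
  have hzero : ∀ y ∈ S 0, 0 ≤ y := by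
    rintro y ⟨t, ht, hty⟩
    rw [smul_zero] at hty
    exact nonneg_of_mul_nonneg_right (h0 _ hty) ht
  have hbdd : ∀ v, BddBelow (S v) := by
    intro v
    obtain ⟨z, hz⟩ := hne (-v)
    refine ⟨-z, fun y hy => ?_⟩
    have := hadd _ _ _ _ hy hz
    rw [add_neg_cancel] at this
    linarith [hzero _ this]
  obtain ⟨L, -, hL⟩ := exists_extension_of_le_sublinear (⊥ : E →ₗ.[ℝ] ℝ) (fun v => sInf (S v))
    (fun c hc v => by
      have : S (c • v) = c • S v := by
        ext y
        rw [mem_smul_set_iff_inv_smul_mem₀ hc.ne']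
        constructor
        · rintro ⟨t, ht, h⟩
          refine ⟨t * c, by positivity, ?_⟩
          rw [mul_smul, smul_eq_mul, mul_assoc, mul_inv_cancel_left₀ hc.ne']
          exact h
        · rintro ⟨t, ht, h⟩
          refine ⟨t / c, by positivity, ?_⟩
          rw [smul_smul, div_mul_cancel₀ _ hc.ne', div_mul_eq_mul_div, mul_div_assoc]
          rwa [smul_eq_mul, inv_mul_eq_div] at h
      simp only [this, Real.sInf_smul_of_nonneg hc.le, smul_eq_mul])
    (fun v w => by
      have h1 : sInf (S (v + w)) - sInf (S v) ≤ sInf (S w) :=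
        le_csInf (hne w) fun z hz => by
          have : sInf (S (v + w)) - z ≤ sInf (S v) := le_csInf (hne v) fun y hy => by
            linarith [csInf_le (hbdd (v + w)) (hadd v w y z hy hz)]
          linarith
      linarith)
    (fun x => by
      have hx : (x : E) = 0 := (Submodule.mem_bot ℝ).1 x.2
      have hx' : x = 0 := Subtype.ext hx
      rw [hx', LinearPMap.map_zero]
      exact Real.sInf_nonneg hzero)
  exact ⟨L, fun v r h => (hL v).trans (csInf_le (hbdd v) (hmem v r h))⟩

section

variable {Ω : Type*} [MeasurableSpace Ω]

/-! ### The conjugate integral functional -/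

section conjugate

variable {f : ℝ → EReal} {Q : Measure Ω} {g h : Ω → ℝ}

theorem exists_integrable_convexConj (hf : IsDivergenceFunction f) [IsFiniteMeasure Q]
    (hg : g ∈ boundedMeasurable Ω)
    (hne : erealIntegral Q (fun x => convexConj f (g x)) ≠ ⊤) :
    ∃ v : Ω → ℝ, Integrable v Q ∧ (fun x => convexConj f (g x)) =ᵐ[Q] (fun x => (v x : EReal)) ∧
      erealIntegral Q (fun x => convexConj f (g x)) = ((∫ x, v x ∂Q : ℝ) : EReal) := by
  obtain ⟨v, hv, hgv⟩ := exists_integrable_of_erealIntegral_ne_top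
    (u := fun x => convexConj f (g x)) (hf.measurable_convexConj.comp hg.1)
    (FinAddProb.integrable_of_mem_boundedMeasurable (μ := Q) hg)
    (fun x => hf.le_convexConj (g x)) hne
  refine ⟨v, hv, hgv, ?_⟩
  rw [erealIntegral_congr_ae hgv, erealIntegral_coe hv]

theorem erealIntegral_convexConj_ne_bot (hf : IsDivergenceFunction f) [IsFiniteMeasure Q]
    (hg : g ∈ boundedMeasurable Ω) :
    erealIntegral Q (fun x => convexConj f (g x)) ≠ ⊥ := by
  by_cases hne : erealIntegral Q (fun x => convexConj f (g x)) = ⊤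
  · simp [hne]
  · obtain ⟨v, -, -, hv⟩ := exists_integrable_convexConj hf hg hne
    rw [hv]
    exact EReal.coe_ne_bot _

theorem erealIntegral_convexConj_combo_le (hf : IsDivergenceFunction f) [IsFiniteMeasure Q]
    (hg : g ∈ boundedMeasurable Ω) (hh : h ∈ boundedMeasurable Ω) {a b r s : ℝ}
    (ha : 0 ≤ a) (hb : 0 ≤ b) (hab : a + b = 1)
    (hr : erealIntegral Q (fun x => convexConj f (g x)) ≤ (r : EReal))
    (hs : erealIntegral Q (fun x => convexConj f (h x)) ≤ (s : EReal)) :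
    erealIntegral Q (fun x => convexConj f ((a • g + b • h) x)) ≤
      ((a * r + b * s : ℝ) : EReal) := by
  obtain ⟨v, hv, hgv, hv'⟩ := exists_integrable_convexConj hf hg (ne_top_of_le_ne_top
    (EReal.coe_ne_top r) hr)
  obtain ⟨w, hw, hhw, hw'⟩ := exists_integrable_convexConj hf hh (ne_top_of_le_ne_top
    (EReal.coe_ne_top s) hs)
  rw [hv', EReal.coe_le_coe_iff] at hr
  rw [hw', EReal.coe_le_coe_iff] at hs
  have hle : erealIntegral Q (fun x => convexConj f ((a • g + b • h) x)) ≤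
      erealIntegral Q (fun x => ((a * v x + b * w x : ℝ) : EReal)) := by
    refine erealIntegral_mono_ae ?_
    filter_upwards [hgv, hhw] with x hx hx'
    exact IsDivergenceFunction.convexConj_combo_le hx.le hx'.le ha hb hab
  have hvw : Integrable (fun x => a * v x + b * w x) Q := (hv.const_mul a).add (hw.const_mul b)
  rw [erealIntegral_coe hvw,
    integral_add (hv.const_mul a) (hw.const_mul b), integral_const_mul, integral_const_mul] at hle
  refine hle.trans (EReal.coe_le_coe_iff.2 ?_)
  gcongr

/-- An a.e. bound is what absolute continuity needs: there the test functions may exceed `s` on a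
`Q`-null set. -/
theorem erealIntegral_convexConj_le_of_ae_le (hf : IsDivergenceFunction f)
    [IsProbabilityMeasure Q] {s c : ℝ} (hsc : convexConj f s ≤ (c : EReal))
    (hg : ∀ᵐ x ∂Q, g x ≤ s) :
    erealIntegral Q (fun x => convexConj f (g x)) ≤ (c : EReal) := by
  have h1 : erealIntegral Q (fun _ : Ω => (c : EReal)) = (c : EReal) := by
    rw [erealIntegral_coe (integrable_const c)]
    simp
  rw [← h1]
  refine erealIntegral_mono_ae ?_
  filter_upwards [hg] with x hx using (hf.convexConj_mono hx).trans hsc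

end conjugate

/-! ### The variational formula -/

/-- A measurable choice of an index at which a finite family of functions is largest. -/
theorem exists_measurable_argmax {l : ℕ → Ω → ℝ} (hl : ∀ n, Measurable (l n)) (n : ℕ) :
    ∃ N : Ω → ℕ, Measurable N ∧ Measurable (fun x => l (N x) x) ∧ (∀ x, N x ≤ n) ∧
      ∀ x, ∀ i ≤ n, l i x ≤ l (N x) x := by
  classical
  induction n with
  | zero =>
    exact ⟨fun _ => 0, measurable_const, hl 0, fun _ => le_rfl, fun x i hi => by
      rw [Nat.le_zero.1 hi]⟩
  | succ n ih =>
    obtain ⟨N, hN, hlN, hNn, hmax⟩ := ih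
    have hset : MeasurableSet {x | l (N x) x < l (n + 1) x} := measurableSet_lt hlN (hl _)
    refine ⟨fun x => if l (N x) x < l (n + 1) x then n + 1 else N x,
      Measurable.ite hset measurable_const hN, ?_, fun x => ?_, fun x i hi => ?_⟩
    · have h1 : Measurable fun x => if l (N x) x < l (n + 1) x then l (n + 1) x else l (N x) x :=
        Measurable.ite hset (hl (n + 1)) hlN
      convert h1 using 2 with x
      simp only
      split_ifs <;> rfl
    · have := hNn x
      simp only
      split_ifs <;> omega
    · rcases hi.lt_or_eq with hi | rfl
      · have h1 := hmax x i (by omega)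
        simp only
        split_ifs with h
        · exact h1.trans h.le
        · exact h1
      · simp only
        split_ifs with h
        · exact le_rfl
        · exact not_lt.1 h

namespace FinAddProb

variable {f : ℝ → EReal} {P : FinAddProb Ω} {Q : Measure Ω} [IsProbabilityMeasure Q] {h : Ω → ℝ}

theorem integrable_rnDeriv_mul (hP : P.IsCountablyAdditive) (hPQ : P.AbsCont Q)
    (hh : h ∈ boundedMeasurable Ω) :
    Integrable (fun x => ((P.toMeasure hP).rnDeriv Q x).toReal * h x) Q := by
  have := isProbabilityMeasure_toMeasure hP
  exact (integrable_rnDeriv_smul_iff (toMeasure_absolutelyContinuous hP hPQ)).2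
    (integrable_of_mem_boundedMeasurable hh)

theorem expect_eq_integral_rnDeriv (hP : P.IsCountablyAdditive) (hPQ : P.AbsCont Q)
    (hh : h ∈ boundedMeasurable Ω) :
    P.expect h = ∫ x, ((P.toMeasure hP).rnDeriv Q x).toReal * h x ∂Q := by
  have := isProbabilityMeasure_toMeasure hP
  rw [expect_eq_integral hP hh]
  exact (integral_rnDeriv_smul (toMeasure_absolutelyContinuous hP hPQ)).symm

theorem measurable_rnDeriv_toReal {Q : Measure Ω} (hP : P.IsCountablyAdditive) :
    Measurable fun x => ((P.toMeasure hP).rnDeriv Q x).toReal :=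
  (Measure.measurable_rnDeriv _ _).ennreal_toReal

/-- Integrate the Fenchel–Young inequality `ρ h - f*(h) ≤ f(ρ)` with `ρ = dP/dQ`; the cases where an
integral is `⊤` are trivial. -/
theorem sub_le_fDiv (hf : IsDivergenceFunction f) (hP : P.IsCountablyAdditive)
    (hPQ : P.AbsCont Q) (hh : h ∈ boundedMeasurable Ω) :
    (P.expect h : EReal) - erealIntegral Q (fun x => convexConj f (h x)) ≤
      fDiv f (P.toMeasure hP) Q := by
  by_cases h1 : erealIntegral Q (fun x => convexConj f (h x)) = ⊤
  · simp [h1]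
  by_cases h2 : fDiv f (P.toMeasure hP) Q = ⊤
  · simp [h2]
  obtain ⟨v, hv, hhv, hv'⟩ := exists_integrable_convexConj hf hh h1
  obtain ⟨s, c, hsc⟩ := hf.exists_convexConj_le
  obtain ⟨w, hw, hhw⟩ := exists_integrable_of_erealIntegral_ne_top
    (hf.measurable.comp (measurable_rnDeriv_toReal (Q := Q) hP))
    ((integrable_rnDeriv_mul hP hPQ (const_mem_boundedMeasurable s)).sub (integrable_const c))
    (fun x => convexConj_le_coe_iff.1 hsc _) h2
  have h3 : fDiv f (P.toMeasure hP) Q = ((∫ x, w x ∂Q : ℝ) : EReal) := by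
    rw [← erealIntegral_coe hw, ← erealIntegral_congr_ae hhw]
    rfl
  rw [h3, hv', ← EReal.coe_sub, EReal.coe_le_coe_iff, expect_eq_integral_rnDeriv hP hPQ hh,
    ← integral_sub (integrable_rnDeriv_mul hP hPQ hh) hv]
  refine integral_mono_ae ((integrable_rnDeriv_mul hP hPQ hh).sub hv) hw ?_
  filter_upwards [hhv, hhw] with x hx hx'
  have h4 := convexConj_le_coe_iff.1 hx.le ((P.toMeasure hP).rnDeriv Q x).toReal
  have h5 := h4.trans hx'.le
  exact EReal.coe_le_coe_iff.1 h5

theorem sub_le_extFDiv (hf : IsDivergenceFunction f) (hh : h ∈ boundedMeasurable Ω) :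
    (P.expect h : EReal) - erealIntegral Q (fun x => convexConj f (h x)) ≤ extFDiv f P Q := by
  unfold extFDiv
  split_ifs with hP
  · exact sub_le_fDiv hf hP.1 hP.2 hh
  · exact le_iSup₂ (f := fun h (_ : h ∈ boundedMeasurable Ω) =>
      (P.expect h : EReal) - erealIntegral Q (fun x => convexConj f (h x))) h hh

/-- The test function `h_n` is the slope of the largest of the minorants `0, …, n` at `ρ = dP/dQ`.
It takes finitely many values, `f*(h_n)` is at most the matching constant, and the maxima increase
to `f(ρ)`. -/
theorem fDiv_le_of_forall (hf : IsDivergenceFunction f) (hP : P.IsCountablyAdditive)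
    (hPQ : P.AbsCont Q) {M : ℝ}
    (hM : ∀ h ∈ boundedMeasurable Ω,
      (P.expect h : EReal) - erealIntegral Q (fun x => convexConj f (h x)) ≤ (M : EReal)) :
    fDiv f (P.toMeasure hP) Q ≤ (M : EReal) := by
  obtain ⟨s, c, hsc, hsup⟩ := hf.exists_countable_minorants
  set ρ : Ω → ℝ := fun x => ((P.toMeasure hP).rnDeriv Q x).toReal with hρ
  have hρm : Measurable ρ := measurable_rnDeriv_toReal hP
  choose N hN hlN hNn hmax using fun n => exists_measurable_argmax
    (l := fun n x => ρ x * s n - c n) (fun n => (hρm.mul_const _).sub_const _) n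
  have hbdd : ∀ (a : ℕ → ℝ) (n : ℕ), (fun x => a (N n x)) ∈ boundedMeasurable Ω := by
    intro a n
    refine ⟨(measurable_from_top (f := a)).comp (hN n), ∑ i ∈ Finset.range (n + 1), |a i|,
      fun x => ?_⟩
    exact Finset.single_le_sum (f := fun i => |a i|) (fun _ _ => abs_nonneg _)
      (Finset.mem_range.2 (Nat.lt_succ_of_le (hNn n x)))
  have hint : ∀ n, Integrable (fun x => c (N n x)) Q := fun n =>
    integrable_of_mem_boundedMeasurable (hbdd c n)
  have hmul : ∀ n, Integrable (fun x => ρ x * s (N n x)) Q := fun n =>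
    integrable_rnDeriv_mul hP hPQ (hbdd s n)
  refine erealIntegral_le_of_le_iSup (φ := fun n x => ρ x * s (N n x) - c (N n x))
    (hf.measurable.comp hρm) hlN (fun n => (hmul n).sub (hint n)) ?_ ?_ ?_ ?_
  · intro m n hmn x
    exact hmax n x _ ((hNn m x).trans hmn)
  · intro x
    exact convexConj_le_coe_iff.1 (hsc _) _
  · intro x
    refine (hsup (ρ x)).trans (iSup_mono fun n => ?_)
    exact EReal.coe_le_coe_iff.2 (hmax n x n le_rfl)
  · intro n
    have h1 : erealIntegral Q (fun x => convexConj f (s (N n x))) ≤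
        ((∫ x, c (N n x) ∂Q : ℝ) : EReal) := by
      rw [← erealIntegral_coe (hint n)]
      exact erealIntegral_mono_ae (Filter.Eventually.of_forall fun x => hsc _)
    have h2 := (EReal.sub_le_sub le_rfl h1).trans (hM _ (hbdd s n))
    rw [← EReal.coe_sub, EReal.coe_le_coe_iff, expect_eq_integral_rnDeriv hP hPQ (hbdd s n)] at h2
    rw [integral_sub (hmul n) (hint n)]
    exact h2

theorem extFDiv_le_of_forall (hf : IsDivergenceFunction f) {M : ℝ}
    (hM : ∀ h ∈ boundedMeasurable Ω,
      (P.expect h : EReal) - erealIntegral Q (fun x => convexConj f (h x)) ≤ (M : EReal)) :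
    extFDiv f P Q ≤ (M : EReal) := by
  unfold extFDiv
  split_ifs with hP
  · exact fDiv_le_of_forall hf hP.1 hP.2 hM
  · exact iSup₂_le hM

end FinAddProb

/-! ### Duality -/

theorem nonpos_of_forall_mul_le {x K : ℝ} (h : ∀ t : ℝ, 0 ≤ t → t * x ≤ K) : x ≤ 0 := by
  by_contra! hx
  have h1 := h ((|K| + 1) / x) (by positivity)
  rw [div_mul_cancel₀ _ hx.ne'] at h1
  linarith [le_abs_self K]

variable {f : ℝ → EReal} {H : Set (Ω → ℝ)} {P : FinAddProb Ω} {Q : Measure Ω}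
  [IsProbabilityMeasure Q]

/-- If the restricted divergence is bounded by a real number, some finitely additive probability
measure separates the restricted problem from the conjugate integral functional. -/
theorem exists_absCont_forall_le (hf : IsDivergenceFunction f) (hHB : H ⊆ boundedMeasurable Ω)
    (hHconv : Convex ℝ H) (hHshift : ∀ h ∈ H, ∀ b : ℝ, (fun x => h x + b) ∈ H)
    (hne : H.Nonempty) {D : ℝ} (hD : restrictedFDiv f H P Q ≤ (D : EReal)) :
    ∃ P' : FinAddProb Ω, P'.AbsCont Q ∧ ∀ g ∈ boundedMeasurable Ω, ∀ r : ℝ,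
      erealIntegral Q (fun x => convexConj f (g x)) ≤ (r : EReal) → ∀ h ∈ H,
        P'.expect g - r + (P.expect h - P'.expect h) ≤ D := by
  obtain ⟨s, c, hsc⟩ := hf.exists_convexConj_le
  obtain ⟨h₀, hh₀⟩ := hne
  -- The epigraph of `v ↦ inf_{h ∈ H} (E_Q[f*(v + h)] - E_P[h]) + D`, up to attainment. Its fibre
  -- over `0` is nonnegative exactly because `D` bounds the restricted divergence.
  let C : Set (boundedMeasurableSubmodule Ω × ℝ) := {p | ∃ h ∈ H,
    erealIntegral Q (fun x => convexConj f ((p.1.1 + h) x)) ≤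
      ((p.2 + P.expect h - D : ℝ) : EReal)}
  obtain ⟨L, hL⟩ := exists_linearMap_le_of_convex (C := C)
    (by
      rintro ⟨v, r⟩ ⟨h, hh, hr⟩ ⟨w, t⟩ ⟨k, hk, ht⟩ a b ha hb hab
      refine ⟨a • h + b • k, hHconv hh hk ha hb hab, ?_⟩
      have h1 := erealIntegral_convexConj_combo_le hf
        ((boundedMeasurableSubmodule Ω).add_mem v.2 (hHB hh))
        ((boundedMeasurableSubmodule Ω).add_mem w.2 (hHB hk)) ha hb hab hr ht
      rw [P.expect_combo (hHB hh) (hHB hk) ha hb]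
      convert h1 using 2
      · ext x
        simp only [Prod.fst_add, Prod.smul_fst, Submodule.coe_add, Submodule.coe_smul,
          Pi.add_apply, Pi.smul_apply, smul_eq_mul]
        congr 1
        ring
      · simp only [Prod.snd_add, Prod.smul_snd, smul_eq_mul]
        linear_combination D * hab)
    (by
      rintro r ⟨h, hh, hr⟩
      simp only [ZeroMemClass.coe_zero, zero_add] at hr
      have h1 : (P.expect h : EReal) - ((r + P.expect h - D : ℝ) : EReal) ≤ (D : EReal) :=
        (EReal.sub_le_sub le_rfl hr).trans ((le_iSup₂ (f := fun h (_ : h ∈ H) =>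
          (P.expect h : EReal) - erealIntegral Q (fun x => convexConj f (h x))) h hh).trans hD)
      rw [← EReal.coe_sub, EReal.coe_le_coe_iff] at h1
      linarith)
    (by
      intro v
      obtain ⟨-, K, hK⟩ := (boundedMeasurableSubmodule Ω).add_mem v.2 (hHB hh₀)
      -- Shifting `h₀` by `s - K` brings `v + h₀` below `s`, where `f*` is at most `c`.
      refine ⟨c - P.expect (fun x => h₀ x + (s - K)) + D, _, hHshift h₀ hh₀ (s - K), ?_⟩
      have : c - P.expect (fun x => h₀ x + (s - K)) + D + P.expect (fun x => h₀ x + (s - K)) - D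
          = c := by ring
      simp only [this]
      refine erealIntegral_convexConj_le_of_ae_le hf hsc (Filter.Eventually.of_forall fun x => ?_)
      have := (abs_le.1 (hK x)).2
      simp only [Pi.add_apply] at this ⊢
      linarith)
  have key : ∀ g : boundedMeasurableSubmodule Ω, ∀ r : ℝ,
      erealIntegral Q (fun x => convexConj f (g.1 x)) ≤ (r : EReal) → ∀ h (hh : h ∈ H),
        L g - L ⟨h, hHB hh⟩ ≤ r - P.expect h + D := by
    intro g r hg h hh
    rw [← map_sub]
    -- Membership in `C` is used at `v = g - h`, so that `v + h = g`.
    refine hL _ _ ⟨h, hh, ?_⟩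
    convert hg using 2
    · ext x
      simp
    · ring
  let one : boundedMeasurableSubmodule Ω := ⟨fun _ => 1, const_mem_boundedMeasurable 1⟩
  have hsone : ∀ᵐ x ∂Q, (s • one).1 x ≤ s := Filter.Eventually.of_forall fun x => by simp [one]
  have hLone : L one = 1 := by
    -- Shifting `h₀` by an arbitrary `b` of either sign leaves the bound fixed, which forces `L 1 =
    -- 1`.
    have h1 : ∀ b : ℝ, b * (1 - L one) ≤
        c - P.expect h₀ + D - L (s • one) + L ⟨h₀, hHB hh₀⟩ := by
      intro b
      have h2 := key (s • one) c (erealIntegral_convexConj_le_of_ae_le hf hsc hsone) _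
        (hHshift h₀ hh₀ b)
      have h3 : (⟨fun x => h₀ x + b, hHB (hHshift h₀ hh₀ b)⟩ : boundedMeasurableSubmodule Ω) =
          ⟨h₀, hHB hh₀⟩ + b • one := by
        ext x
        simp [one]
      rw [h3, map_add, map_smul L b, smul_eq_mul, P.expect_add_const (hHB hh₀)] at h2
      linarith
    have h2 := nonpos_of_forall_mul_le fun t _ => h1 t
    have h3 : L one - 1 ≤ 0 :=
      nonpos_of_forall_mul_le fun t _ => le_trans (by linarith) (h1 (-t))
    linarith
  have hnonpos : ∀ v : boundedMeasurableSubmodule Ω, (∀ᵐ x ∂Q, v.1 x ≤ 0) → L v ≤ 0 := by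
    intro v hv
    refine nonpos_of_forall_mul_le (K := c - P.expect h₀ + D - L (s • one) + L ⟨h₀, hHB hh₀⟩)
      fun t ht => ?_
    -- For every `t ≥ 0` the function `s + t v` stays below `s` a.e., so `t * L v` is bounded above
    -- uniformly in `t`.
    have h1 := key (s • one + t • v) c (erealIntegral_convexConj_le_of_ae_le hf hsc (by
      filter_upwards [hv] with x hx
      have := mul_nonpos_of_nonneg_of_nonpos ht hx
      simp only [Submodule.coe_add, Submodule.coe_smul, Pi.add_apply, Pi.smul_apply, smul_eq_mul,
        one, mul_one]
      linarith)) h₀ hh₀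
    rw [map_add, map_smul L t, smul_eq_mul] at h1
    linarith
  obtain ⟨P', hP', hcont⟩ := FinAddProb.exists_expect_eq L
    (fun v hv => by
      have := hnonpos (-v) (Filter.Eventually.of_forall fun x => neg_nonpos.2 (hv x))
      rw [map_neg] at this
      linarith) hLone
  refine ⟨P', fun E hE h0 => ?_, fun g hg r hr h hh => ?_⟩
  · have h1 : (P'.content E : ℝ) ≤ 0 := by
      rw [hcont E hE]
      refine hnonpos _ ?_
      filter_upwards [measure_eq_zero_iff_ae_notMem.1 h0] with x hx
      simp [hx]
    exact le_antisymm (NNReal.coe_le_coe.1 h1) bot_le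
  · have h1 := key ⟨g, hg⟩ r hr h hh
    rw [← hP', ← hP'] at h1
    simp only at h1
    linarith

theorem restrictedFDiv_le_extFDiv_add (hf : IsDivergenceFunction f)
    (hHB : H ⊆ boundedMeasurable Ω) (P' : FinAddProb Ω) :
    restrictedFDiv f H P Q ≤
      extFDiv f P' Q + ⨆ h ∈ H, ((P.expect h - P'.expect h : ℝ) : EReal) := by
  refine iSup₂_le fun h hh => ?_
  -- Only the conjugate integral can be infinite, so the regrouping is also valid at `⊤` and `⊥`.
  have h1 : (P.expect h : EReal) - erealIntegral Q (fun x => convexConj f (h x)) =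
      ((P'.expect h : EReal) - erealIntegral Q (fun x => convexConj f (h x))) +
        ((P.expect h - P'.expect h : ℝ) : EReal) := by
    generalize erealIntegral Q (fun x => convexConj f (h x)) = y
    induction y with
    | bot => simp [-EReal.coe_sub]
    | top => simp [-EReal.coe_sub]
    | coe y =>
      norm_cast
      ring
  rw [h1]
  exact add_le_add (FinAddProb.sub_le_extFDiv hf (hHB hh))
    (le_iSup₂ (f := fun h (_ : h ∈ H) => ((P.expect h - P'.expect h : ℝ) : EReal)) h hh)

theorem exists_absCont_extFDiv_add_le (hf : IsDivergenceFunction f)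
    (hHB : H ⊆ boundedMeasurable Ω) (hHconv : Convex ℝ H)
    (hHshift : ∀ h ∈ H, ∀ b : ℝ, (fun x => h x + b) ∈ H) :
    ∃ P' : FinAddProb Ω, P'.AbsCont Q ∧
      extFDiv f P' Q + (⨆ h ∈ H, ((P.expect h - P'.expect h : ℝ) : EReal)) ≤
        restrictedFDiv f H P Q := by
  rcases H.eq_empty_or_nonempty with rfl | ⟨h₀, hh₀⟩
  -- For empty `H` both sides are `⊥`, since `x + ⊥ = ⊥` in `EReal` even for `x = ⊤`; any `P' ≪ Q`
  -- will do.
  · exact ⟨FinAddProb.ofMeasure Q, FinAddProb.absCont_ofMeasure Q, by simp⟩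
  by_cases htop : restrictedFDiv f H P Q = ⊤
  · exact ⟨FinAddProb.ofMeasure Q, FinAddProb.absCont_ofMeasure Q, by simp [htop]⟩
  obtain ⟨s, c, hsc⟩ := hf.exists_convexConj_le
  have hle : ∀ h ∈ H, (P.expect h : EReal) - erealIntegral Q (fun x => convexConj f (h x)) ≤
      restrictedFDiv f H P Q := fun h hh => le_iSup₂ (f := fun h (_ : h ∈ H) =>
        (P.expect h : EReal) - erealIntegral Q (fun x => convexConj f (h x))) h hh
  have hbot : restrictedFDiv f H P Q ≠ ⊥ := by
    obtain ⟨-, K, hK⟩ := hHB hh₀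
    have h1 : erealIntegral Q (fun x => convexConj f (h₀ x + (s - K))) ≤ (c : EReal) :=
      erealIntegral_convexConj_le_of_ae_le hf hsc (Filter.Eventually.of_forall fun x => by
        linarith [(abs_le.1 (hK x)).2])
    have h2 := (EReal.sub_le_sub le_rfl h1).trans (hle _ (hHshift h₀ hh₀ (s - K)))
    rw [← EReal.coe_sub] at h2
    exact ne_bot_of_le_ne_bot (EReal.coe_ne_bot _) h2
  obtain ⟨D, hD⟩ : ∃ D : ℝ, restrictedFDiv f H P Q = (D : EReal) :=
    ⟨_, (EReal.coe_toReal htop hbot).symm⟩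
  obtain ⟨P', hP'Q, hP'⟩ := exists_absCont_forall_le hf hHB hHconv hHshift ⟨h₀, hh₀⟩ hD.le
  refine ⟨P', hP'Q, ?_⟩
  rw [hD]
  have h1 : ∀ h ∈ H, extFDiv f P' Q ≤ ((D - (P.expect h - P'.expect h) : ℝ) : EReal) := by
    intro h hh
    refine FinAddProb.extFDiv_le_of_forall hf fun g hg => ?_
    by_cases hgt : erealIntegral Q (fun x => convexConj f (g x)) = ⊤
    · simp [hgt]
    · have hr := EReal.coe_toReal hgt (erealIntegral_convexConj_ne_bot hf hg)
      rw [← hr, ← EReal.coe_sub, EReal.coe_le_coe_iff]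
      linarith [hP' g hg _ hr.ge h hh]
  have h2 : extFDiv f P' Q ≠ ⊥ := by
    refine ne_bot_of_le_ne_bot ?_
      (FinAddProb.sub_le_extFDiv (P := P') (Q := Q) hf (const_mem_boundedMeasurable s))
    have h3 : erealIntegral Q (fun _ : Ω => convexConj f s) ≤ (c : EReal) :=
      erealIntegral_convexConj_le_of_ae_le (g := fun _ => s) hf hsc
        (Filter.Eventually.of_forall fun x => le_rfl)
    refine ne_bot_of_le_ne_bot ?_ (EReal.sub_le_sub le_rfl h3)
    rw [← EReal.coe_sub]
    exact EReal.coe_ne_bot _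
  -- Finiteness of the divergence lets it move across the inequality, after which the supremum over
  -- `h` can be taken.
  obtain ⟨e, he⟩ : ∃ e : ℝ, extFDiv f P' Q = (e : EReal) :=
    ⟨_, (EReal.coe_toReal (ne_top_of_le_ne_top (EReal.coe_ne_top _) (h1 h₀ hh₀)) h2).symm⟩
  rw [he] at h1 ⊢
  have h3 : (⨆ h ∈ H, ((P.expect h - P'.expect h : ℝ) : EReal)) ≤ ((D - e : ℝ) : EReal) := by
    refine iSup₂_le fun h hh => EReal.coe_le_coe_iff.2 ?_
    linarith [EReal.coe_le_coe_iff.1 (h1 h hh)]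
  refine (add_le_add le_rfl h3).trans ?_
  rw [← EReal.coe_add, add_sub_cancel]

end

theorem corollary1 {Ω : Type*} [MeasurableSpace Ω]
    (f : ℝ → EReal) (hf : IsDivergenceFunction f)
    (H : Set (Ω → ℝ)) (hHB : H ⊆ boundedMeasurable Ω) (hHconv : Convex ℝ H)
    (hHshift : ∀ h ∈ H, ∀ b : ℝ, (fun x => h x + b) ∈ H)
    (P : FinAddProb Ω) (Q : Measure Ω) [IsProbabilityMeasure Q] :
    restrictedFDiv f H P Q =
        (⨅ P' : FinAddProb Ω,
          extFDiv f P' Q + ⨆ h ∈ H, ((P.expect h - P'.expect h : ℝ) : EReal)) ∧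
      restrictedFDiv f H P Q =
        (⨅ (P' : FinAddProb Ω) (_ : P'.AbsCont Q),
          extFDiv f P' Q + ⨆ h ∈ H, ((P.expect h - P'.expect h : ℝ) : EReal)) := by
  obtain ⟨P', hP'Q, hP'⟩ := exists_absCont_extFDiv_add_le (P := P) (Q := Q) hf hHB hHconv hHshift
  refine ⟨le_antisymm (le_iInf fun P' => restrictedFDiv_le_extFDiv_add hf hHB P')
    ((iInf_le _ P').trans hP'),
    le_antisymm (le_iInf₂ fun P' _ => restrictedFDiv_le_extFDiv_add hf hHB P')
    ((iInf₂_le P' hP'Q).trans hP')⟩
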